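/- **Setting.** Let $\mathcal G=\mathrm{SE}_3\times\mathbb R^6$ with product $(E,v)(E',v')=(EE',v+v')$, Lie algebra $\mathfrak g=\mathfrak{se}_3\times\mathbb R^6$, bracket $[(\xi_1,\xi_2),(\eta_1,\eta_2)]=(\xi_1\eta_1-\eta_1\xi_1,0)$, $G\eta:=(E\eta_1,\eta_2)$ for $G=(E,v)$, $\operatorname{Exp}(\eta)=(e^{\eta_1},\eta_2)$, and the left-invariant metric $\langle G\xi,G\eta\rangle_G=\operatorname{tr}(\xi_1^\top\eta_1)+\langle\xi_2,\eta_2\rangle$. Let $$\operatorname{mat}_{\mathfrak{se}}(u)=\begin{pmatrix}0&-u_3/\sqrt2&u_2/\sqrt2&u_4\\u_3/\sqrt2&0&-u_1/\sqrt2&u_5\\-u_2/\sqrt2&u_1/\sqrt2&0&u_6\\0&0&0&0\end{pmatrix},$$ $\operatorname{vec}_{\mathfrak{se}}=\operatorname{mat}_{\mathfrak{se}}^{-1}$, $\operatorname{mat}_{\mathfrak g}(u)=(\operatorname{mat}_{\mathfrak{se}}(u_{1:6}),u_{7:12})$, $\operatorname{vec}_{\mathfrak g}=\operatorname{mat}_{\mathfrak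 g}^{-1}$. The left-trivialized differential of a map $\psi$ on $\mathcal G$ with values in $\mathbb R^m$, at $G$, is the Jacobian at $u=0$ of $u\mapsto\psi(G\operatorname{Exp}(\operatorname{mat}_{\mathfrak g}u))$; for maps into $\mathfrak g$ one composes with $\operatorname{vec}_{\mathfrak g}$. Let $\operatorname{ad}(u)\in\mathbb R^{12\times12}$ be the matrix of $\eta\mapsto[\operatorname{mat}_{\mathfrak g}u,\eta]$ in the coordinates $\operatorname{vec}_{\mathfrak g}$. **The filter on $\mathcal G$.** Consider a state equation $\dot G=G(f(G)+\delta)$, with covariance $S$ of $\delta$, and observations $z_l=h(G(t_l))+\epsilon_l\in\mathbb R^m$ at times $t_1<t_2<\dots$, with covariance $Q_l$ of $\epsilon_l$. The continuous-discrete extended Kalman filter of Bourmaud et al. does the following in step $l$, starting from $G(t_{l-1})\in\mathcal G$ and the covariance matrix $P(t_{l-1})$. *Propagation*: on $[t_{l-1},t_l]$ solve $$\dot G=G\,f(G),$$ $$\dot P=JP+PJ^\top+S+\tfrac14\mathbb E\bigl(\operatorname{ad}(\varepsilon)S\operatorname{ad}(\varepsilon)^\top\bigr)+\tfrac1{12}\mathbb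 E\bigl(\operatorname{ad}(\varepsilon)^2\bigr)S+\tfrac1{12}S\,\mathbb E\bigl(\operatorname{ad}(\varepsilon)^2\bigr)^\top,\qquad\varepsilon\sim\mathcal N(0,P(t)),$$ with $G\in\mathcal G$ and $P$ positive semidefinite; call the values at $t_l$ $G^-$ and $P^-$. *Update*: $$K_l=P^-H_l^\top(H_lP^-H_l^\top+Q_l)^{-1},\quad m_l=K_lr_l,\quad G(t_l)=G^-\operatorname{Exp}(\operatorname{mat}_{\mathfrak g}m_l),\quad P(t_l)=\Phi(m_l)(\mathbb 1_{12}-K_lH_l)P^-\Phi(m_l)^\top.$$ Here $r_l=z_l-h(G^-)$, $H_l$ is the left-trivialized differential of $h$ at $G^-$, $\Phi(u)=\sum_{m\ge0}\frac{(-1)^m}{(m+1)!}\operatorname{ad}(u)^m$, and $J(t)=F(t)-\operatorname{ad}(\operatorname{vec}_{\mathfrak g}f(G(t)))+\frac1{12}C(S)$, where $F(t)$ is the left-trivialized differential of $f$ at $G(t)$ and $C(S)=\sum_{i,j}S_{ij}\operatorname{ad}(e_i)\operatorname{ad}(e_j)$. **The model.** Let $f(E,v)=(\operatorname{mat}_{\mathfrak{se}}(v),0)$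 (constant acceleration). For $k=1,\dots,n$ let $y_k=h_k(E,t)+\epsilon_k\in\mathbb R^2$, where $h_k(E,t)=\pi((E^{-1}g_k(t))_{1:3})$, $\pi(p)=p_3^{-1}(p_1,p_2)^\top$, and $g_k(t)=(d_k(t)x^k_1,d_k(t)x^k_2,d_k(t),1)^\top$ for a pixel $x^k\in\mathbb R^2$ with depth $d_k(t)$. The observations are aggregated: $z_l=\sum_ky_k(t_l)$, $h=\sum_kh_k$ and $Q_l\in\mathbb R^{2\times2}$. Let $S$ and all $Q_l$ be symmetric positive definite. Put $\kappa_k=\kappa_k(E)=e_3^\top E^{-1}g_k$. **Proposition.** The extended Kalman filter of Bourmaud et al. for this model is given by the above algorithm with the following explicit expressions. That is, for every finite number of steps, states and covariances form a run of that filter if and only if they satisfy the algorithm with these expressions, provided that $\kappa_k\neq0$ for all $k$ at each predicted state. 1. $r_l=\sum_{k=1}^n\bigl(y_k(t_l)-h_k(E^-,t_l)\bigr)$, where $G^-=(E^-,v^-)$. 2. $J(t)=F-\operatorname{ad}(\operatorname{vec}_{\mathfrak g}f(G(t)))+\tfrac1{12}C(S)$ with $$F=\begin{pmatrix}0&\mathbb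 1_6\\0&0\end{pmatrix},\qquad\operatorname{ad}(u)=\begin{pmatrix}\operatorname{ad}_{\mathfrak{se}}(u_{1:6})&0\\0&0\end{pmatrix},\qquad\operatorname{ad}_{\mathfrak{se}}(u)=\begin{pmatrix}\operatorname{mat}_{\mathfrak{so}}(u_{1:3})&0\\\operatorname{mat}_{\mathfrak{so}}(u_{4:6})&\operatorname{mat}_{\mathfrak{so}}(u_{1:3})\end{pmatrix},$$ where $\operatorname{mat}_{\mathfrak{so}}(u_{1:3})$ is the upper left $3\times3$ block of $\operatorname{mat}_{\mathfrak{se}}(u)$. If $S$ is diagonal, then $C(S)=\operatorname{diag}(\Xi,\Xi,0_{6\times6})$ with $\Xi=-\tfrac12\operatorname{diag}(S_{22}+S_{33},S_{11}+S_{33},S_{11}+S_{22})$. 3. $\Phi(u)=\operatorname{diag}(\Phi_{\mathrm{SE}_3}(u_{1:6}),\mathbb 1_6)$ with $\Phi_{\mathrm{SE}_3}(u)=\sum_{m\ge0}\frac{(-1)^m}{(m+1)!}\operatorname{ad}_{\mathfrak{se}}(u)^m$. 4. $$H_l=\sum_{k=1}^n\begin{pmatrix}\operatorname{vec}_{\mathfrak{se}}(\operatorname{Pr}(\rho_k^1))^\top&0_{1\times6}\\\operatorname{vec}_{\mathfrak{se}}(\operatorname{Pr}(\rho_k^2))^\top&0_{1\times6}\end{pmatrix},\qquad\rho_k^j=\bigl(\kappa_k^{-2}E^{-1}g_k\,(e_j^\top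 E^{-1}g_k)\,e_3^\top-\kappa_k^{-1}E^{-1}g_ke_j^\top\bigr)^\top,$$ evaluated at the predicted state $G^-$ and at $t_l$, where $\operatorname{Pr}(A)=\tfrac12\operatorname{diag}(1,1,1,0)\bigl(A\operatorname{diag}(1,1,1,2)-A^\top\operatorname{diag}(1,1,1,0)\bigr)$ is the projection onto $\mathfrak{se}_3$. This is the summed left-trivialized Riemannian gradient of the $h_k$: whenever $\kappa_k(E)\ne0$, the Riemannian gradient of the component $h_k^j$ at $G=(E,v)\in\mathcal G$ is $G(\operatorname{Pr}(\rho_k^j),0)$, and if $\kappa_k(E)\neq0$ for all $k$, the matrix $H_l$ formed at $G$ is the left-trivialized differential of $\sum_kh_k$ at $G$. -/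

import Mathlib

open Matrix Set MeasureTheory ProbabilityTheory
open scoped Nat

noncomputable section

namespace EgoMotion

/-! ### The Lie group `𝒢 = SE₃ × ℝ⁶` and its Lie algebra -/

/-- Real `4 × 4` matrices. -/
abbrev M4 := Matrix (Fin 4) (Fin 4) ℝ

/-- The ambient space `ℝ^{4×4} × ℝ⁶`; it contains both the group `𝒢` and its tangent spaces. -/
abbrev Amb := M4 × (Fin 6 → ℝ)

/-- The index set of the twelve coordinates of the Lie algebra, in two blocks of six. -/
abbrev Ix := Fin 6 ⊕ Fin 6

/-- Real `12 × 12` matrices, in four blocks of size `6 × 6`. -/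
abbrev M12 := Matrix Ix Ix ℝ

/-- The matrix with rotation part `R` and translation part `w`. -/
def rigid (R : Matrix (Fin 3) (Fin 3) ℝ) (w : Fin 3 → ℝ) : M4 :=
  !![R 0 0, R 0 1, R 0 2, w 0;
     R 1 0, R 1 1, R 1 2, w 1;
     R 2 0, R 2 1, R 2 2, w 2;
     0, 0, 0, 1]

/-- The special Euclidean group `SE₃`. -/
def SE3 : Set M4 :=
  {E | ∃ R ∈ Matrix.specialOrthogonalGroup (Fin 3) ℝ, ∃ w : Fin 3 → ℝ, E = rigid R w}

/-- The Lie algebra `𝔰𝔢₃`: skew-symmetric upper left `3 × 3` block, vanishing last row. -/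
def se3 : Set M4 :=
  {A | (∀ i j : Fin 3, A i.castSucc j.castSucc = -A j.castSucc i.castSucc) ∧ ∀ j, A 3 j = 0}

/-- The group `𝒢 = SE₃ × ℝ⁶`. -/
def grp : Set Amb := {G | G.1 ∈ SE3}

/-- The Lie algebra `𝔤 = 𝔰𝔢₃ × ℝ⁶`. -/
def lieAlg : Set Amb := {ξ | ξ.1 ∈ se3}

/-- The group law of `𝒢`: matrix product in `SE₃`, addition in `ℝ⁶`. -/
def gmul (G G' : Amb) : Amb := (G.1 * G'.1, G.2 + G'.2)

/-- The tangent map of the left translation by `G` at the identity, `G η = (E η₁, η₂)`. -/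
def tmap (G ξ : Amb) : Amb := (G.1 * ξ.1, ξ.2)

/-- The exponential map of `𝒢`. -/
def gexp (ξ : Amb) : Amb := (NormedSpace.exp ξ.1, ξ.2)

/-- The Lie bracket of `𝔤`: matrix commutator on `𝔰𝔢₃`, zero on `ℝ⁶`. -/
def bracket (ξ η : Amb) : Amb := (ξ.1 * η.1 - η.1 * ξ.1, 0)

/-- `mat_𝔰𝔢 : ℝ⁶ → 𝔰𝔢₃`. -/
def matSe (u : Fin 6 → ℝ) : M4 :=
  !![0, -(u 2 / √2), u 1 / √2, u 3;
     u 2 / √2, 0, -(u 0 / √2), u 4;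
     -(u 1 / √2), u 0 / √2, 0, u 5;
     0, 0, 0, 0]

/-- `vec_𝔰𝔢`, the inverse of `mat_𝔰𝔢` on `𝔰𝔢₃`. -/
def vecSe (A : M4) : Fin 6 → ℝ := ![√2 * A 2 1, √2 * A 0 2, √2 * A 1 0, A 0 3, A 1 3, A 2 3]

/-- `mat_𝔤 : ℝ¹² → 𝔤`. -/
def matG (u : Ix → ℝ) : Amb := (matSe (fun i => u (Sum.inl i)), fun i => u (Sum.inr i))

/-- `vec_𝔤`, the inverse of `mat_𝔤` on `𝔤`. -/
def vecG (ξ : Amb) : Ix → ℝ := Sum.elim (vecSe ξ.1) ξ.2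

theorem vecSe_matSe (u : Fin 6 → ℝ) : vecSe (matSe u) = u := by
  have h : (√2 : ℝ) ≠ 0 := by positivity
  funext i
  fin_cases i <;> simp [vecSe, matSe] <;> field_simp

theorem vecG_matG (u : Ix → ℝ) : vecG (matG u) = u := by
  funext i
  rcases i with i | i <;> simp [vecG, matG, vecSe_matSe]

/-- The left-invariant Riemannian metric
`⟨ξ, η⟩_G = tr((E⁻¹ξ₁)ᵀ (E⁻¹η₁)) + ⟨ξ₂, η₂⟩` on `𝒢`, for `G = (E, v)`. -/
def metric (G ξ η : Amb) : ℝ :=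
  ((G.1⁻¹ * ξ.1)ᵀ * (G.1⁻¹ * η.1)).trace + ξ.2 ⬝ᵥ η.2

/-- `γ` is the Riemannian gradient of `ψ : 𝒢 → ℝ` at `G`: a tangent vector at `G` with
`dψ(G)[Gη] = ⟨γ, Gη⟩_G` for all `η ∈ 𝔤`. The differential is taken in the chart
`u ↦ G Exp(mat_𝔤 u)`, and `η = mat_𝔤 u`. -/
def IsRiemannianGradient (ψ : Amb → ℝ) (G γ : Amb) : Prop :=
  (∃ η ∈ lieAlg, γ = tmap G η) ∧
  ∃ D : (Ix → ℝ) →L[ℝ] ℝ,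
    HasFDerivAt (fun u : Ix → ℝ => ψ (gmul G (gexp (matG u)))) D 0 ∧
    ∀ u, D u = metric G γ (tmap G (matG u))

/-- `A` is the matrix of the left-trivialized differential at `G` of a vector-valued map `ψ` on
`𝒢`: the Jacobian at `0` of `u ↦ ψ(G Exp(mat_𝔤 u))`. -/
def IsLeftDifferential {ι : Type} [Fintype ι] (ψ : Amb → ι → ℝ) (G : Amb) (A : Matrix ι Ix ℝ) :
    Prop :=
  HasFDerivAt (fun u : Ix → ℝ => ψ (gmul G (gexp (matG u))))
    (LinearMap.toContinuousLinearMap A.mulVecLin) 0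

/-- The matrix, in the coordinates `vec_𝔤`, of the adjoint `ad_𝔤(ξ) η = [ξ, η]`, `ξ = mat_𝔤 u`. -/
def adG (u : Ix → ℝ) : M12 :=
  Matrix.of fun i j => vecG (bracket (matG u) (matG (Pi.single j 1))) i

/-- The power series `∑ₘ (-1)ᵐ / (m+1)! Aᵐ`. -/
def phiSeries {ι : Type} [Fintype ι] [DecidableEq ι] (A : Matrix ι ι ℝ) : Matrix ι ι ℝ :=
  ∑' m : ℕ, ((-1 : ℝ) ^ m / ((m + 1)! : ℝ)) • A ^ m

/-- The right Jacobian `Φ` of the exponential map of `𝒢`, in coordinates. -/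
def phiG (u : Ix → ℝ) : M12 := phiSeries (adG u)

/-- The second-order correction `C(S) = ∑ᵢⱼ Sᵢⱼ ad(eᵢ) ad(eⱼ)`, that is the expectation of
`ad(ν)²` for Lie algebra noise `ν` with mean zero and covariance `S`. -/
def corr (ad : (Ix → ℝ) → M12) (S : M12) : M12 :=
  ∑ i, ∑ j, S i j • (ad (Pi.single i 1) * ad (Pi.single j 1))

/-! ### The algorithm -/

/-- Entrywise expectation of `ψ(ε)` for a centred Gaussian vector `ε` with covariance `P`. -/
def gaussMean (P : M12) (ψ : (Ix → ℝ) → M12) : M12 :=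
  Matrix.of fun i j =>
    ∫ ε : EuclideanSpace ℝ Ix, ψ (WithLp.ofLp ε) i j ∂(multivariateGaussian 0 P)

/-- Right-hand side of the differential equation of the covariance; `ε` is the Gaussian
left-invariant error, with covariance `P`. -/
def covRhs (ad : (Ix → ℝ) → M12) (J S P : M12) : M12 :=
  J * P + P * Jᵀ + S
    + (1 / 4 : ℝ) • gaussMean P (fun ε => ad ε * S * (ad ε)ᵀ)
    + (1 / 12 : ℝ) • (gaussMean P (fun ε => ad ε ^ 2) * S)
    + (1 / 12 : ℝ) • (S * (gaussMean P (fun ε => ad ε ^ 2))ᵀ)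

/-- The gain `K = P Hᵀ (H P Hᵀ + Q)⁻¹`. -/
def gain {m : ℕ} (P : M12) (H : Matrix (Fin m) Ix ℝ) (Q : Matrix (Fin m) (Fin m) ℝ) :
    Matrix Ix (Fin m) ℝ :=
  P * Hᵀ * (H * P * Hᵀ + Q)⁻¹

/-- One step of the algorithm: propagation on `[a, b]` and update at time `b`. The inputs are the
state `G₀` and the covariance `P₀` at time `a`; the functions `G`, `P` solve the propagation
equations on `[a, b]`, so that `G b`, `P b` are the predicted state and covariance; `G₁`, `P₁` are
the updated ones. The parameters are the drift `f`, the matrices `ad`, `Φ`, the function `J`, the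
noise covariances `S`, `Q`, the residual `r` as a function of the predicted state, and the
observation matrix `H` as a function of the predicted state. -/
structure AlgorithmStep {m : ℕ} (f : Amb → Amb) (ad Φ : (Ix → ℝ) → M12) (J : ℝ → M12) (S : M12)
    (Q : Matrix (Fin m) (Fin m) ℝ) (r : Amb → Fin m → ℝ) (H : Matrix (Fin m) Ix ℝ)
    (a b : ℝ) (G₀ : Amb) (P₀ : M12) (G : ℝ → Amb) (P : ℝ → M12) (G₁ : Amb) (P₁ : M12) : Prop where
  state_init : G a = G₀
  cov_init : P a = P₀
  state_mem : ∀ t ∈ Icc a b, G t ∈ grp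
  cov_mem : ∀ t ∈ Icc a b, (P t).PosSemidef
  state_ode : ∀ t ∈ Icc a b, HasDerivWithinAt G (tmap (G t) (f (G t))) (Icc a b) t
  cov_ode : ∀ t ∈ Icc a b, HasDerivWithinAt P (covRhs ad (J t) S (P t)) (Icc a b) t
  state_update :
    G₁ = gmul (G b) (gexp (matG (gain (P b) H Q *ᵥ r (G b))))
  cov_update :
    P₁ = Φ (gain (P b) H Q *ᵥ r (G b)) * (1 - gain (P b) H Q * H) * P b
      * (Φ (gain (P b) H Q *ᵥ r (G b)))ᵀ

/-- `J` is the linearized drift matrix `F - ad_𝔤(f(G)) + C(S)/12` at the state `G`, where `F` is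
the left-trivialized differential of the drift `f : 𝒢 → 𝔤` at `G`. -/
def IsDriftMatrix (f : Amb → Amb) (S : M12) (G : Amb) (J : M12) : Prop :=
  ∃ F : M12, IsLeftDifferential (fun X => vecG (f X)) G F ∧
    J = F - adG (vecG (f G)) + (1 / 12 : ℝ) • corr adG S

/-- One step of the continuous-discrete extended Kalman filter on the Lie group `𝒢`, for a general
state equation `Ġ = G (f(G) + δ)` with noise covariance `S`, and a general observation
`z = h(G(b)) + ε` in `ℝᵐ` at time `b` with noise covariance `Q`. -/
def LieEKFStep {m : ℕ} (f : Amb → Amb) (h : Amb → Fin m → ℝ) (z : Fin m → ℝ) (S : M12)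
    (Q : Matrix (Fin m) (Fin m) ℝ) (a b : ℝ) (G₀ : Amb) (P₀ : M12) (G : ℝ → Amb) (P : ℝ → M12)
    (G₁ : Amb) (P₁ : M12) : Prop :=
  ∃ (J : ℝ → M12) (H : Matrix (Fin m) Ix ℝ),
    (∀ t ∈ Icc a b, IsDriftMatrix f S (G t) (J t)) ∧
    IsLeftDifferential h (G b) H ∧
    AlgorithmStep f adG phiG J S Q (fun X => z - h X) H a b G₀ P₀ G P G₁ P₁

/-! ### The constant-acceleration model with perspective observations -/

/-- The drift `f(E, v) = (mat_𝔰𝔢 v, 0)`. -/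
def drift (G : Amb) : Amb := (matSe G.2, 0)

/-- The perspective projection `π : ℝ³ → ℝ²`. -/
def persp (p : Fin 3 → ℝ) : Fin 2 → ℝ := (p 2)⁻¹ • ![p 0, p 1]

/-- The data vector `(d x₁, d x₂, d, 1)` of a pixel `x` with depth `d`. -/
def dataVec (x : Fin 2 → ℝ) (d : ℝ) : Fin 4 → ℝ := ![d * x 0, d * x 1, d, 1]

/-- The observation function `h(E) = π((E⁻¹ g)_{1:3})`. -/
def obs (g : Fin 4 → ℝ) (E : M4) : Fin 2 → ℝ := persp (fun i => (E⁻¹ *ᵥ g) i.castSucc)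

/-- `κ = e₃ᵀ E⁻¹ g`. -/
def kappa (g : Fin 4 → ℝ) (E : M4) : ℝ := (E⁻¹ *ᵥ g) 2

/-- The projection `Pr : ℝ^{4×4} → 𝔰𝔢₃`. -/
def prSe (A : M4) : M4 :=
  (1 / 2 : ℝ) • (diagonal ![1, 1, 1, 0] *
    (A * diagonal ![1, 1, 1, 2] - Aᵀ * diagonal ![1, 1, 1, 0]))

/-- `ρʲ = (κ⁻² E⁻¹ g (eⱼᵀ E⁻¹ g) e₃ᵀ - κ⁻¹ E⁻¹ g eⱼᵀ)ᵀ`, `j = 1, 2`. -/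
def rho (g : Fin 4 → ℝ) (E : M4) (j : Fin 2) : M4 :=
  ((kappa g E ^ 2)⁻¹ • (E⁻¹ *ᵥ g) (Fin.castLE (by omega) j) •
      vecMulVec (E⁻¹ *ᵥ g) (Pi.single 2 1)
    - (kappa g E)⁻¹ • vecMulVec (E⁻¹ *ᵥ g) (Pi.single (Fin.castLE (by omega) j) 1))ᵀ

/-- The explicit observation matrix `H_l`: row `j` is `∑ₖ (vec_𝔰𝔢(Pr(ρₖʲ))ᵀ, 0)`. -/
def obsMatrix {n : ℕ} (g : Fin n → Fin 4 → ℝ) (E : M4) : Matrix (Fin 2) Ix ℝ :=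
  ∑ k, Matrix.of fun j => Sum.elim (vecSe (prSe (rho (g k) E j))) 0

/-- `mat_𝔰𝔬`: the upper left `3 × 3` block of `mat_𝔰𝔢`. -/
def matSo (w : Fin 3 → ℝ) : Matrix (Fin 3) (Fin 3) ℝ :=
  !![0, -(w 2 / √2), w 1 / √2;
     w 2 / √2, 0, -(w 0 / √2);
     -(w 1 / √2), w 0 / √2, 0]

/-- The explicit adjoint matrix on `𝔰𝔢₃`, with blocks
`(mat_𝔰𝔬 u_{1:3}, 0; mat_𝔰𝔬 u_{4:6}, mat_𝔰𝔬 u_{1:3})`. -/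
def adSeVec (u : Fin 6 → ℝ) : Matrix (Fin 6) (Fin 6) ℝ :=
  (fromBlocks (matSo ![u 0, u 1, u 2]) 0 (matSo ![u 3, u 4, u 5])
    (matSo ![u 0, u 1, u 2])).submatrix
      (finSumFinEquiv (m := 3) (n := 3)).symm (finSumFinEquiv (m := 3) (n := 3)).symm

/-- The explicit adjoint matrix on `𝔤`. -/
def adGVec (u : Ix → ℝ) : M12 := fromBlocks (adSeVec (fun i => u (Sum.inl i))) 0 0 0

/-- The explicit form of `Φ`: the block diagonal matrix with blocks `Φ_{SE₃}(u_{1:6})` and `1`. -/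
def phiVec (u : Ix → ℝ) : M12 :=
  fromBlocks (phiSeries (adSeVec (fun i => u (Sum.inl i)))) 0 0 1

/-- The matrix `F` with blocks `(0, 1; 0, 0)`. -/
def driftDiff : M12 := fromBlocks 0 1 0 0

/-- The explicit function `J = F - ad_𝔤(f(G)) + C(S)/12`. -/
def driftMatrix (S : M12) (G : Amb) : M12 :=
  driftDiff - adGVec (vecG (drift G)) + (1 / 12 : ℝ) • corr adGVec S

/-- The explicit form of `C(S)` for the diagonal matrix `S` with entries `s`: the upper left block
is `diag(Ξ, Ξ)` with `Ξ = -½ diag(s₂ + s₃, s₁ + s₃, s₁ + s₂)`, the other blocks vanish. -/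
def corrDiag (s : Ix → ℝ) : M12 :=
  fromBlocks
    (diagonal ![-(s (.inl 1) + s (.inl 2)) / 2, -(s (.inl 0) + s (.inl 2)) / 2,
      -(s (.inl 0) + s (.inl 1)) / 2, -(s (.inl 1) + s (.inl 2)) / 2,
      -(s (.inl 0) + s (.inl 2)) / 2, -(s (.inl 0) + s (.inl 1)) / 2]) 0 0 0

end EgoMotion

end

open EgoMotion

/-!
The derivative of `exp` at `0` is the identity. In the chart `u ↦ G Exp(mat_𝔤 u)` an observation
is the perspective quotient of `exp(-mat_𝔰𝔢 u) q` with `q = E⁻¹g`, so its differential at `u = 0`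
is `u ↦ tr((ρʲ)ᵀ mat_𝔰𝔢 u)`. Since `mat_𝔰𝔢` is an isometry for the trace inner product and `Pr` is
the orthogonal projection onto `𝔰𝔢₃`, this equals `⟨vec_𝔰𝔢 (Pr ρʲ), u⟩`: the rows of the
left-trivialized differential are the coordinates of the left-trivialized Riemannian gradients.

Left-trivialized differentials are unique, so the `F` and `H` quantified existentially in a filter
step are forced to be the explicit ones, while `ad` and `Φ` agree with their explicit forms by
block matrix algebra. For diagonal `S` the formula for `C(S)` comes from
`mat_𝔰𝔬(w)² = ½(w wᵀ - |w|² 1)`; translations contribute nothing, since `ad(e₄)`, `ad(e₅)`,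
`ad(e₆)` square to zero.
-/

namespace EgoMotion

theorem hasFDerivAt_inv_mul_apply {ι : Type*} [Finite ι] {p : ι → ℝ} {a : ι} (ha : p a ≠ 0)
    (c : ι) :
    HasFDerivAt (fun p : ι → ℝ => (p a)⁻¹ * p c)
      ((p a)⁻¹ • ContinuousLinearMap.proj c
        - ((p a ^ 2)⁻¹ * p c) • ContinuousLinearMap.proj a : (ι → ℝ) →L[ℝ] ℝ) p := by
  cases nonempty_fintype ι
  refine (((hasFDerivAt_inv ha).comp p (hasFDerivAt_apply a p)).mul
    (hasFDerivAt_apply c p)).congr_fderiv ?_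
  ext v
  simp only [_root_.add_apply, _root_.sub_apply, _root_.smul_apply, smul_eq_mul,
    ContinuousLinearMap.proj_apply, ContinuousLinearMap.comp_apply,
    ContinuousLinearMap.toSpanSingleton_apply]
  ring

section Exponential

variable {ι V : Type*} [Fintype ι] [DecidableEq ι] [NormedAddCommGroup V] [NormedSpace ℝ V]

attribute [local instance] Matrix.linftyOpNormedRing Matrix.linftyOpNormedAlgebra

theorem hasFDerivAt_exp_comp_zero (L : V →L[ℝ] Matrix ι ι ℝ) :
    HasFDerivAt (fun u => NormedSpace.exp (L u)) L 0 := by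
  have h : HasFDerivAt (NormedSpace.exp : Matrix ι ι ℝ → Matrix ι ι ℝ)
      (1 : Matrix ι ι ℝ →L[ℝ] Matrix ι ι ℝ) (L 0) := by
    rw [map_zero]
    exact hasFDerivAt_exp_zero
  exact h.comp 0 L.hasFDerivAt

theorem hasFDerivAt_exp_mulVec (L : V →L[ℝ] Matrix ι ι ℝ) (q : ι → ℝ) :
    HasFDerivAt (fun u => NormedSpace.exp (L u) *ᵥ q)
      ((LinearMap.toContinuousLinearMap ((mulVecBilin ℝ ℝ).flip q)).comp L) 0 := by
  let evalAt : Matrix ι ι ℝ →L[ℝ] ι → ℝ :=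
    LinearMap.toContinuousLinearMap ((mulVecBilin ℝ ℝ).flip q)
  have h := evalAt.hasFDerivAt.comp (0 : V) (hasFDerivAt_exp_comp_zero L)
  exact h

theorem summable_phiSeries {ι : Type} [Fintype ι] [DecidableEq ι] (A : Matrix ι ι ℝ) :
    Summable fun m : ℕ => ((-1 : ℝ) ^ m / ((m + 1)! : ℝ)) • A ^ m := by
  refine .of_norm_bounded_eventually_nat (Real.summable_pow_div_factorial ‖A‖) ?_
  filter_upwards [Filter.eventually_gt_atTop 0] with m hm
  calc ‖((-1 : ℝ) ^ m / ((m + 1)! : ℝ)) • A ^ m‖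
      = ‖A ^ m‖ / ((m + 1)! : ℝ) := by
        rw [norm_smul, norm_div, norm_pow, norm_neg, norm_one, one_pow, Real.norm_natCast,
          one_div_mul_eq_div]
    _ ≤ ‖A‖ ^ m / (m ! : ℝ) := by
        gcongr
        exacts [norm_pow_le' A hm, m.le_succ]

end Exponential

theorem phiSeries_zero {ι : Type} [Fintype ι] [DecidableEq ι] :
    phiSeries (0 : Matrix ι ι ℝ) = 1 := by
  rw [phiSeries, tsum_eq_single 0 fun m hm => by rw [zero_pow hm, smul_zero]]
  simp

theorem phiSeries_fromBlocks_diagonal {ι κ : Type} [Fintype ι] [DecidableEq ι] [Fintype κ]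
    [DecidableEq κ] (A : Matrix ι ι ℝ) (D : Matrix κ κ ℝ) :
    phiSeries (fromBlocks A 0 0 D) = fromBlocks (phiSeries A) 0 0 (phiSeries D) := by
  let diagBlocks : Matrix ι ι ℝ × Matrix κ κ ℝ →+ Matrix (ι ⊕ κ) (ι ⊕ κ) ℝ :=
    { toFun := fun p => fromBlocks p.1 0 0 p.2
      map_zero' := fromBlocks_zero
      map_add' := fun p q => by simp [fromBlocks_add] }
  have hcont : Continuous diagBlocks :=
    continuous_fst.matrix_fromBlocks continuous_const continuous_const continuous_snd
  have hsum := ((summable_phiSeries A).hasSum.prodMk (summable_phiSeries D).hasSum).map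
    diagBlocks hcont
  refine Eq.trans (tsum_congr fun m => ?_) hsum.tsum_eq
  simp [diagBlocks, fromBlocks_diagonal_pow, fromBlocks_smul]

theorem matSe_vecSe {A : M4} (hA : A ∈ se3) : matSe (vecSe A) = A := by
  obtain ⟨hskew, hrow⟩ := hA
  have hdiag (i : Fin 3) : A i.castSucc i.castSucc = 0 := self_eq_neg.1 (hskew i i)
  have h00 : A 0 0 = 0 := hdiag 0
  have h11 : A 1 1 = 0 := hdiag 1
  have h22 : A 2 2 = 0 := hdiag 2
  have h01 : A 0 1 = -A 1 0 := hskew 0 1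
  have h20 : A 2 0 = -A 0 2 := hskew 2 0
  have h12 : A 1 2 = -A 2 1 := hskew 1 2
  ext i j
  fin_cases i <;> fin_cases j <;>
    simp [matSe, vecSe, h00, h11, h22, h01, h20, h12, hrow]

theorem prSe_apply (A : M4) (i j : Fin 4) :
    prSe A i j =
      1 / 2 * (![1, 1, 1, 0] i * (A i j * ![1, 1, 1, 2] j - A j i * ![1, 1, 1, 0] j)) := by
  simp only [prSe, Matrix.smul_apply, diagonal_mul, mul_diagonal, Matrix.sub_apply,
    transpose_apply, smul_eq_mul]

theorem prSe_mem_se3 (A : M4) : prSe A ∈ se3 := by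
  refine ⟨fun i j => ?_, fun j => ?_⟩
  · fin_cases i <;> fin_cases j <;> simp [prSe_apply] <;> ring
  · simp [prSe_apply]

theorem trace_transpose_matSe_mul_matSe (u v : Fin 6 → ℝ) :
    ((matSe u)ᵀ * matSe v).trace = u ⬝ᵥ v := by
  have hsqrt : √2 * √2 = (2 : ℝ) := Real.mul_self_sqrt zero_le_two
  simp only [trace, diag_apply, mul_apply, transpose_apply, Fin.sum_univ_four, dotProduct,
    Fin.sum_univ_six, matSe, of_apply, cons_val', cons_val_zero, cons_val_one, cons_val,
    cons_val_fin_one, mul_neg, neg_mul, div_mul_div_comm, hsqrt]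
  ring

theorem trace_transpose_prSe_mul (A : M4) {B : M4} (hB : B ∈ se3) :
    ((prSe A)ᵀ * B).trace = (Aᵀ * B).trace := by
  rw [← matSe_vecSe hB]
  simp only [trace, diag_apply, mul_apply, transpose_apply, Fin.sum_univ_four,
    prSe_apply, matSe, of_apply, cons_val', cons_val_zero, cons_val_one, cons_val,
    cons_val_fin_one]
  ring

theorem matSe_mem_se3 (u : Fin 6 → ℝ) : matSe u ∈ se3 := by
  refine ⟨fun i j => ?_, fun j => ?_⟩
  · fin_cases i <;> fin_cases j <;> simp [matSe]
  · fin_cases j <;> rfl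

theorem vecSe_prSe_dotProduct (A : M4) (u : Fin 6 → ℝ) :
    vecSe (prSe A) ⬝ᵥ u = (Aᵀ * matSe u).trace := by
  rw [← trace_transpose_matSe_mul_matSe, matSe_vecSe (prSe_mem_se3 A),
    trace_transpose_prSe_mul A (matSe_mem_se3 u)]

theorem vecSe_commutator (u v : Fin 6 → ℝ) :
    vecSe (matSe u * matSe v - matSe v * matSe u) = adSeVec u *ᵥ v := by
  have h2 : (√2 : ℝ) ≠ 0 := by positivity
  funext i
  fin_cases i <;>
    simp [vecSe, matSe, adSeVec, matSo, mulVec, dotProduct, Fin.sum_univ_six,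
      finSumFinEquiv, Fin.addCases] <;>
    field_simp <;> ring

theorem vecG_bracket_matG (u v : Ix → ℝ) :
    vecG (bracket (matG u) (matG v)) = adGVec u *ᵥ v := by
  simp [vecG, bracket, matG, adGVec, fromBlocks_mulVec, vecSe_commutator, Function.comp_def]

theorem adG_eq_adGVec : adG = adGVec := by
  ext u i j
  rw [adG, of_apply, vecG_bracket_matG, mulVec_single_one, col_apply]

theorem phiG_eq_phiVec : phiG = phiVec := by
  ext1 u
  rw [phiG, adG_eq_adGVec, adGVec, phiSeries_fromBlocks_diagonal, phiSeries_zero, phiVec]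

theorem corr_diagonal (ad : (Ix → ℝ) → M12) (s : Ix → ℝ) :
    corr ad (diagonal s) = ∑ i, s i • ad (Pi.single i 1) ^ 2 := by
  refine Finset.sum_congr rfl fun i _ => ?_
  rw [Finset.sum_eq_single i (fun j _ hji => by simp [diagonal_apply_ne' s hji]) (by simp),
    diagonal_apply_eq, sq]

theorem sum_smul_fromBlocks_diagonal {α ι κ : Type*} (s : Finset α) (c : α → ℝ)
    (A : α → Matrix ι ι ℝ) (D : α → Matrix κ κ ℝ) :
    ∑ i ∈ s, c i • fromBlocks (A i) 0 0 (D i) =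
      fromBlocks (∑ i ∈ s, c i • A i) 0 0 (∑ i ∈ s, c i • D i) := by
  ext (i | i) (j | j) <;> simp [Matrix.sum_apply]

theorem matSo_sq (w : Fin 3 → ℝ) :
    matSo w ^ 2 = (1 / 2 : ℝ) • (vecMulVec w w - (w ⬝ᵥ w) • 1) := by
  have hsqrt : √2 * √2 = (2 : ℝ) := Real.mul_self_sqrt zero_le_two
  ext i j
  fin_cases i <;> fin_cases j <;>
    simp [sq, matSo, mul_apply, Fin.sum_univ_three, vecMulVec_apply, dotProduct,
      div_mul_div_comm, hsqrt] <;> ring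

theorem sum_smul_matSo_single_sq (s : Fin 3 → ℝ) :
    ∑ i, s i • matSo (Pi.single i 1) ^ 2
      = diagonal ![-(s 1 + s 2) / 2, -(s 0 + s 2) / 2, -(s 0 + s 1) / 2] := by
  simp only [matSo_sq]
  ext i j
  fin_cases i <;> fin_cases j <;> simp [Fin.sum_univ_three, vecMulVec_apply] <;> ring

theorem matSo_zero : matSo 0 = 0 := by
  ext i j
  fin_cases i <;> fin_cases j <;> simp [matSo]

theorem adSeVec_zero : adSeVec 0 = 0 := by
  have h : ![0, 0, 0] = (0 : Fin 3 → ℝ) := by simp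
  simp [adSeVec, h, matSo_zero]

theorem adSeVec_append_sq (a b : Fin 3 → ℝ) :
    adSeVec (Fin.append a b) ^ 2 =
      (fromBlocks (matSo a ^ 2) 0 (matSo b * matSo a + matSo a * matSo b)
        (matSo a ^ 2)).submatrix finSumFinEquiv.symm finSumFinEquiv.symm := by
  have ha : ![Fin.append a b 0, Fin.append a b 1, Fin.append a b 2] = a := by
    ext i
    fin_cases i <;> rfl
  have hb : ![Fin.append a b 3, Fin.append a b 4, Fin.append a b 5] = b := by
    ext i
    fin_cases i <;> rfl
  simp only [adSeVec, ha, hb, sq, submatrix_mul_equiv, fromBlocks_multiply, Matrix.mul_zero,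
    Matrix.zero_mul, add_zero, zero_add]

theorem sum_smul_adSeVec_single_sq (s : Fin 6 → ℝ) :
    ∑ i, s i • adSeVec (Pi.single i 1) ^ 2 =
      diagonal ![-(s 1 + s 2) / 2, -(s 0 + s 2) / 2, -(s 0 + s 1) / 2,
        -(s 1 + s 2) / 2, -(s 0 + s 2) / 2, -(s 0 + s 1) / 2] := by
  have hrot (i : Fin 3) : adSeVec (Pi.single (Fin.castAdd 3 i) 1) ^ 2 =
      (fromBlocks (matSo (Pi.single i 1) ^ 2) 0 0 (matSo (Pi.single i 1) ^ 2)).submatrix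
        finSumFinEquiv.symm finSumFinEquiv.symm := by
    have hi : Pi.single (Fin.castAdd 3 i) 1 = Fin.append (Pi.single i 1 : Fin 3 → ℝ) 0 := by
      fin_cases i <;> ext k <;> fin_cases k <;> rfl
    simp [hi, adSeVec_append_sq, matSo_zero]
  have htrans (i : Fin 3) : adSeVec (Pi.single (Fin.natAdd 3 i) 1) ^ 2 = 0 := by
    have hi : Pi.single (Fin.natAdd 3 i) 1 = Fin.append 0 (Pi.single i 1 : Fin 3 → ℝ) := by
      fin_cases i <;> ext k <;> fin_cases k <;> rfl
    rw [hi, adSeVec_append_sq, matSo_zero]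
    simp
  have hΞ := sum_smul_matSo_single_sq fun i => s (Fin.castAdd 3 i)
  calc ∑ i, s i • adSeVec (Pi.single i 1) ^ 2
      = ∑ i : Fin 3, s (Fin.castAdd 3 i) • adSeVec (Pi.single (Fin.castAdd 3 i) 1) ^ 2
        + ∑ i : Fin 3, s (Fin.natAdd 3 i) • adSeVec (Pi.single (Fin.natAdd 3 i) 1) ^ 2 :=
          Fin.sum_univ_add (a := 3) (b := 3) fun i => s i • adSeVec (Pi.single i 1) ^ 2
    _ = (fromBlocks (∑ i, s (Fin.castAdd 3 i) • matSo (Pi.single i 1) ^ 2) 0 0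
          (∑ i, s (Fin.castAdd 3 i) • matSo (Pi.single i 1) ^ 2)).submatrix
            finSumFinEquiv.symm finSumFinEquiv.symm := by
        simp only [htrans, hrot, smul_zero, Finset.sum_const_zero, add_zero,
          ← sum_smul_fromBlocks_diagonal]
        ext i j
        simp [Matrix.sum_apply]
    _ = _ := by
        rw [hΞ, fromBlocks_diagonal, submatrix_diagonal_equiv]
        congr 1
        ext k
        fin_cases k <;> rfl

theorem adGVec_sq (u : Ix → ℝ) :
    adGVec u ^ 2 = fromBlocks (adSeVec (fun i => u (Sum.inl i)) ^ 2) 0 0 0 := by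
  simp [adGVec, sq, fromBlocks_multiply]

theorem corr_adGVec_diagonal (s : Ix → ℝ) : corr adGVec (diagonal s) = corrDiag s := by
  have hse (i : Fin 6) : adGVec (Pi.single (Sum.inl i) 1) ^ 2 =
      fromBlocks (adSeVec (Pi.single i 1) ^ 2) 0 0 0 := by
    rw [← Sum.elim_single_zero, adGVec_sq]
    rfl
  have hvel (i : Fin 6) : adGVec (Pi.single (Sum.inr i) 1) ^ 2 = 0 := by
    rw [← Sum.elim_zero_single, adGVec_sq]
    change fromBlocks (adSeVec 0 ^ 2) 0 0 0 = 0
    rw [adSeVec_zero, zero_pow two_ne_zero, fromBlocks_zero]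
  rw [corr_diagonal, Fintype.sum_sum_type, corrDiag,
    ← sum_smul_adSeVec_single_sq fun i => s (Sum.inl i)]
  simp only [hse, hvel, smul_zero, Finset.sum_const_zero, add_zero, sum_smul_fromBlocks_diagonal]

section LeftDifferential

variable {ι : Type} [Fintype ι] {G : Amb}

theorem IsLeftDifferential.unique {ψ : Amb → ι → ℝ} {A B : Matrix ι Ix ℝ}
    (hA : IsLeftDifferential ψ G A) (hB : IsLeftDifferential ψ G B) :
    A = B :=
  Matrix.toLin'.injective (LinearMap.toContinuousLinearMap.injective (HasFDerivAt.unique hA hB))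

theorem IsLeftDifferential.sum {κ : Type*} {s : Finset κ} {ψ : κ → Amb → ι → ℝ}
    {A : κ → Matrix ι Ix ℝ} (h : ∀ k ∈ s, IsLeftDifferential (ψ k) G (A k)) :
    IsLeftDifferential (fun X => ∑ k ∈ s, ψ k X) G (∑ k ∈ s, A k) := by
  refine (HasFDerivAt.fun_sum h).congr_fderiv ?_
  ext u : 1
  simp

theorem isUnit_det_of_mem_SE3 {E : M4} (hE : E ∈ SE3) : IsUnit E.det := by
  obtain ⟨R, hR, w, rfl⟩ := hE
  have hdet : (rigid R w).det = R.det := by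
    simp [det_succ_row_zero, Fin.sum_univ_succ, rigid, Fin.succAbove]
  rw [hdet, (mem_specialOrthogonalGroup_iff.1 hR).2]
  exact isUnit_one

theorem metric_tmap_matG (hG : IsUnit G.1.det) (u v : Ix → ℝ) :
    metric G (tmap G (matG u)) (tmap G (matG v)) = u ⬝ᵥ v := by
  simp only [metric, tmap, matG, nonsing_inv_mul_cancel_left _ _ hG,
    trace_transpose_matSe_mul_matSe, dotProduct, Fintype.sum_sum_type]

theorem IsLeftDifferential.isRiemannianGradient {ψ : Amb → ι → ℝ} {A : Matrix ι Ix ℝ}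
    (hψ : IsLeftDifferential ψ G A) (hG : IsUnit G.1.det) (i : ι) :
    IsRiemannianGradient (fun X => ψ X i) G (tmap G (matG (A i))) :=
  ⟨⟨matG (A i), matSe_mem_se3 fun j => A i (Sum.inl j), rfl⟩, _, hasFDerivAt_pi'.1 hψ i,
    fun u => (metric_tmap_matG hG (A i) u).symm⟩

end LeftDifferential

section Filter

variable {m : ℕ} {f : Amb → Amb} {S : M12} {Q : Matrix (Fin m) (Fin m) ℝ}
  {H : Matrix (Fin m) Ix ℝ} {a b : ℝ} {G₀ G₁ : Amb} {P₀ P₁ : M12} {G : ℝ → Amb} {P : ℝ → M12}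

theorem isDriftMatrix_iff {X : Amb} {F J : M12}
    (hF : IsLeftDifferential (fun Y => vecG (f Y)) X F) :
    IsDriftMatrix f S X J ↔ J = F - adG (vecG (f X)) + (1 / 12 : ℝ) • corr adG S := by
  refine ⟨?_, fun hJ => ⟨F, hF, hJ⟩⟩
  rintro ⟨F', hF', rfl⟩
  rw [hF'.unique hF]

theorem AlgorithmStep.congr_J {ad Φ : (Ix → ℝ) → M12} {J J' : ℝ → M12}
    {r : Amb → Fin m → ℝ} (h : AlgorithmStep f ad Φ J S Q r H a b G₀ P₀ G P G₁ P₁)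
    (hJ : ∀ t ∈ Icc a b, J t = J' t) :
    AlgorithmStep f ad Φ J' S Q r H a b G₀ P₀ G P G₁ P₁ :=
  { h with cov_ode := fun t ht => hJ t ht ▸ h.cov_ode t ht }

theorem lieEKFStep_iff_algorithmStep {h : Amb → Fin m → ℝ} {z : Fin m → ℝ} {F : ℝ → M12}
    (hF : ∀ t ∈ Icc a b, IsLeftDifferential (fun X => vecG (f X)) (G t) (F t))
    (hH : IsLeftDifferential h (G b) H) :
    LieEKFStep f h z S Q a b G₀ P₀ G P G₁ P₁ ↔
      AlgorithmStep f adG phiG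
        (fun t => F t - adG (vecG (f (G t))) + (1 / 12 : ℝ) • corr adG S) S Q
        (fun X => z - h X) H a b G₀ P₀ G P G₁ P₁ := by
  constructor
  · rintro ⟨J, H', hJ, hH', hstep⟩
    rw [hH'.unique hH] at hstep
    exact hstep.congr_J fun t ht => (isDriftMatrix_iff (hF t ht)).1 (hJ t ht)
  · intro hstep
    exact ⟨_, H, fun t ht => (isDriftMatrix_iff (hF t ht)).2 rfl, hH, hstep⟩

end Filter

theorem isLeftDifferential_drift (G : Amb) :
    IsLeftDifferential (fun X => vecG (drift X)) G driftDiff := by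
  have haffine : (fun u : Ix → ℝ => vecG (drift (gmul G (gexp (matG u))))) =
      fun u => Sum.elim G.2 0 + LinearMap.toContinuousLinearMap driftDiff.mulVecLin u := by
    funext u i
    rcases i with i | i <;>
      simp [vecG, drift, vecSe_matSe, gmul, gexp, matG, driftDiff, fromBlocks_mulVec,
        Function.comp_def]
  rw [IsLeftDifferential, haffine]
  exact (ContinuousLinearMap.hasFDerivAt _).const_add _

/-- The `4 × 4` component `u ↦ mat_𝔰𝔢(u_{1:6})` of `mat_𝔤`, as a continuous linear map; the
observations depend on the chart `u ↦ G Exp(mat_𝔤 u)` only through it. -/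
noncomputable def matGFst : (Ix → ℝ) →L[ℝ] M4 :=
  LinearMap.toContinuousLinearMap
    { toFun := fun u => (matG u).1
      map_add' := fun u v => by
        ext i j
        fin_cases i <;> fin_cases j <;> simp [matG, matSe] <;> ring
      map_smul' := fun c u => by
        ext i j
        fin_cases i <;> fin_cases j <;> simp [matG, matSe] <;> ring }

theorem obs_apply (g : Fin 4 → ℝ) (E : M4) (j : Fin 2) :
    obs g E j = ((E⁻¹ *ᵥ g) 2)⁻¹ * (E⁻¹ *ᵥ g) (Fin.castLE (by omega) j) := by
  fin_cases j <;> rfl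

theorem trace_transpose_rho_mul (g : Fin 4 → ℝ) (E M : M4) (j : Fin 2) :
    ((rho g E j)ᵀ * M).trace =
      (kappa g E ^ 2)⁻¹ * (E⁻¹ *ᵥ g) (Fin.castLE (by omega) j) * (M *ᵥ (E⁻¹ *ᵥ g)) 2
        - (kappa g E)⁻¹ * (M *ᵥ (E⁻¹ *ᵥ g)) (Fin.castLE (by omega) j) := by
  have htrace (q : Fin 4 → ℝ) (c : Fin 4) :
      (vecMulVec q (Pi.single c 1) * M).trace = (M *ᵥ q) c := by
    rw [trace_mul_comm, mul_vecMulVec, trace_vecMulVec, dotProduct_single_one]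
  simp only [rho, transpose_transpose, Matrix.sub_mul, smul_mul_assoc, trace_sub, trace_smul,
    htrace, smul_eq_mul, mul_assoc]

/-- The left-trivialized differential of a single observation function `h`: row `j` is
`(vec_𝔰𝔢(Pr(ρʲ))ᵀ, 0)`. The matrix `H_l` is the sum of these. -/
noncomputable def obsDiff (g : Fin 4 → ℝ) (E : M4) : Matrix (Fin 2) Ix ℝ :=
  Matrix.of fun j => Sum.elim (vecSe (prSe (rho g E j))) 0

theorem obsDiff_mulVec (g : Fin 4 → ℝ) (E : M4) (u : Ix → ℝ) (j : Fin 2) :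
    (obsDiff g E *ᵥ u) j = ((rho g E j)ᵀ * (matG u).1).trace := by
  rw [matG, ← vecSe_prSe_dotProduct]
  simp [obsDiff, mulVec, dotProduct]

theorem matG_obsDiff (g : Fin 4 → ℝ) (E : M4) (j : Fin 2) :
    matG (obsDiff g E j) = (prSe (rho g E j), 0) :=
  Prod.ext (matSe_vecSe (prSe_mem_se3 _)) rfl

theorem isLeftDifferential_obs {g : Fin 4 → ℝ} {G : Amb} (hκ : kappa g G.1 ≠ 0) :
    IsLeftDifferential (fun X => obs g X.1) G (obsDiff g G.1) := by
  set q := G.1⁻¹ *ᵥ g with hq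
  have hchart (u : Ix → ℝ) (j : Fin 2) : obs g (gmul G (gexp (matG u))).1 j =
      ((NormedSpace.exp ((-matGFst) u) *ᵥ q) 2)⁻¹ *
        (NormedSpace.exp ((-matGFst) u) *ᵥ q) (Fin.castLE (by omega) j) := by
    rw [obs_apply, gmul, gexp, Matrix.mul_inv_rev, ← Matrix.exp_neg, ← mulVec_mulVec]
    rfl
  have hbase : NormedSpace.exp ((-matGFst) 0) *ᵥ q = q := by
    rw [map_zero, NormedSpace.exp_zero, one_mulVec]
  refine hasFDerivAt_pi'.2 fun j => ?_
  simp only [hchart]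
  have hpersp := hasFDerivAt_inv_mul_apply (p := NormedSpace.exp ((-matGFst) 0) *ᵥ q) (a := 2)
    (by rwa [hbase]) (Fin.castLE (by omega) j)
  refine (hpersp.comp 0 (hasFDerivAt_exp_mulVec (-matGFst) q)).congr_fderiv ?_
  ext u
  trans ((rho g G.1 j)ᵀ * (matG u).1).trace
  · rw [trace_transpose_rho_mul, hbase, ← hq]
    simp only [ContinuousLinearMap.comp_neg, ContinuousLinearMap.sub_comp,
      ContinuousLinearMap.smul_comp, neg_sub, _root_.sub_apply, _root_.smul_apply,
      ContinuousLinearMap.comp_apply, LinearMap.coe_toContinuousLinearMap', LinearMap.flip_apply,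
      mulVecBilin_apply, ContinuousLinearMap.proj_apply, smul_eq_mul]
    rfl
  · exact (obsDiff_mulVec g G.1 u j).symm

theorem isRiemannianGradient_obs {g : Fin 4 → ℝ} {G : Amb} (hG : G ∈ grp)
    (hκ : kappa g G.1 ≠ 0) (j : Fin 2) :
    IsRiemannianGradient (fun X => obs g X.1 j) G (tmap G (prSe (rho g G.1 j), 0)) :=
  matG_obsDiff g G.1 j ▸
    (isLeftDifferential_obs hκ).isRiemannianGradient (isUnit_det_of_mem_SE3 hG) j

theorem isLeftDifferential_sum_obs {n : ℕ} {g : Fin n → Fin 4 → ℝ} {G : Amb}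
    (hκ : ∀ k, kappa (g k) G.1 ≠ 0) :
    IsLeftDifferential (fun X => ∑ k, obs (g k) X.1) G (obsMatrix g G.1) :=
  IsLeftDifferential.sum fun k _ => isLeftDifferential_obs (hκ k)

theorem isDriftMatrix_drift_iff {S : M12} {G : Amb} {J : M12} :
    IsDriftMatrix drift S G J ↔ J = driftMatrix S G := by
  rw [isDriftMatrix_iff (isLeftDifferential_drift G), adG_eq_adGVec, driftMatrix]

theorem lieEKFStep_drift_obs_iff {n : ℕ} {g : Fin n → Fin 4 → ℝ} {z : Fin n → Fin 2 → ℝ}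
    {S : M12} {Q : Matrix (Fin 2) (Fin 2) ℝ} {a b : ℝ} {G₀ : Amb} {P₀ : M12}
    {G : ℝ → Amb} {P : ℝ → M12} {G₁ : Amb} {P₁ : M12} (hκ : ∀ k, kappa (g k) (G b).1 ≠ 0) :
    LieEKFStep drift (fun X => ∑ k, obs (g k) X.1) (∑ k, z k) S Q a b G₀ P₀ G P G₁ P₁ ↔
      AlgorithmStep drift adGVec phiVec (fun t => driftMatrix S (G t)) S Q
        (fun X => ∑ k, (z k - obs (g k) X.1)) (obsMatrix g (G b).1) a b G₀ P₀ G P G₁ P₁ := by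
  simp only [Finset.sum_sub_distrib, driftMatrix, ← adG_eq_adGVec, ← phiG_eq_phiVec]
  exact lieEKFStep_iff_algorithmStep (fun t _ => isLeftDifferential_drift (G t))
    (isLeftDifferential_sum_obs hκ)

end EgoMotion

theorem mainTheorem6_general (n : ℕ) (g : Fin n → ℝ → Fin 4 → ℝ) (y : Fin n → ℝ → Fin 2 → ℝ)
    (S : M12) (N : ℕ) (τ : ℕ → ℝ) (Q : ℕ → Matrix (Fin 2) (Fin 2) ℝ) :
    (∀ G ∈ grp, IsLeftDifferential (fun X => vecG (drift X)) G driftDiff) ∧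
    (∀ u, adG u = adGVec u) ∧
    (∀ u, phiG u = phiVec u) ∧
    (∀ G ∈ grp, ∀ J, IsDriftMatrix drift S G J ↔ J = driftMatrix S G) ∧
    (∀ s : Ix → ℝ, S = diagonal s → corr adGVec S = corrDiag s) ∧
    (∀ (t : ℝ) (G : Amb), G ∈ grp →
      (∀ k (j : Fin 2), kappa (g k t) G.1 ≠ 0 →
        IsRiemannianGradient (fun X => obs (g k t) X.1 j) G
          (tmap G (prSe (rho (g k t) G.1 j), 0))) ∧
      ((∀ k, kappa (g k t) G.1 ≠ 0) →
        IsLeftDifferential (fun X => ∑ k, obs (g k t) X.1) G (obsMatrix (fun k => g k t) G.1))) ∧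
    (∀ (G : ℕ → ℝ → Amb) (P : ℕ → ℝ → M12) (Gpost : ℕ → Amb) (Ppost : ℕ → M12),
      (∀ l < N, ∀ k, kappa (g k (τ (l + 1))) (G l (τ (l + 1))).1 ≠ 0) →
      ((∀ l < N,
          LieEKFStep drift (fun X => ∑ k, obs (g k (τ (l + 1))) X.1)
            (∑ k, y k (τ (l + 1))) S (Q (l + 1)) (τ l) (τ (l + 1))
            (Gpost l) (Ppost l) (G l) (P l) (Gpost (l + 1)) (Ppost (l + 1))) ↔
        (∀ l < N,
          AlgorithmStep drift adGVec phiVec (fun t => driftMatrix S (G l t)) S (Q (l + 1))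
            (fun X => ∑ k, (y k (τ (l + 1)) - obs (g k (τ (l + 1))) X.1))
            (obsMatrix (fun k => g k (τ (l + 1))) (G l (τ (l + 1))).1) (τ l) (τ (l + 1))
            (Gpost l) (Ppost l) (G l) (P l) (Gpost (l + 1)) (Ppost (l + 1))))) := by
  refine ⟨fun G _ => isLeftDifferential_drift G, congrFun adG_eq_adGVec, congrFun phiG_eq_phiVec,
    fun G _ J => isDriftMatrix_drift_iff, ?_, fun t G hG => ⟨?_, isLeftDifferential_sum_obs⟩, ?_⟩
  · rintro s rfl
    exact corr_adGVec_diagonal s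
  · exact fun k j hκ => isRiemannianGradient_obs hG hκ j
  · exact fun G P Gpost Ppost hκ =>
      forall₂_congr fun l hl => lieEKFStep_drift_obs_iff (hκ l hl)

theorem mainTheorem6 (n : ℕ) (x : Fin n → Fin 2 → ℝ) (d : Fin n → ℝ → ℝ)
    (y : Fin n → ℝ → Fin 2 → ℝ)
    (S : M12) (hS : S.PosDef)
    (N : ℕ) (τ : ℕ → ℝ) (hτ : StrictMono τ)
    (Q : ℕ → Matrix (Fin 2) (Fin 2) ℝ) (hQ : ∀ l, (Q l).PosDef) :
    -- `F`, the adjoint and the function `Φ` have the stated explicit forms, so that `J` is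
    -- given by its explicit formula
    (∀ G ∈ grp, IsLeftDifferential (fun X => vecG (drift X)) G driftDiff) ∧
    (∀ u, adG u = adGVec u) ∧
    (∀ u, phiG u = phiVec u) ∧
    (∀ G ∈ grp, ∀ J, IsDriftMatrix drift S G J ↔ J = driftMatrix S G) ∧
    -- the correction `C(S)` for diagonal `S`
    (∀ s : Ix → ℝ, S = diagonal s → corr adGVec S = corrDiag s) ∧
    -- the Riemannian gradients of the observation functions, and `H` as the left-trivialized
    -- differential of their sum
    (∀ (t : ℝ) (G : Amb), G ∈ grp →
      (∀ k (j : Fin 2), kappa (dataVec (x k) (d k t)) G.1 ≠ 0 →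
        IsRiemannianGradient (fun X => obs (dataVec (x k) (d k t)) X.1 j) G
          (tmap G (prSe (rho (dataVec (x k) (d k t)) G.1 j), 0))) ∧
      ((∀ k, kappa (dataVec (x k) (d k t)) G.1 ≠ 0) →
        IsLeftDifferential (fun X => ∑ k, obs (dataVec (x k) (d k t)) X.1) G
          (obsMatrix (fun k => dataVec (x k) (d k t)) G.1))) ∧
    -- the filter of the model is the algorithm with these expressions
    (∀ (G : ℕ → ℝ → Amb) (P : ℕ → ℝ → M12) (Gpost : ℕ → Amb) (Ppost : ℕ → M12),
      (∀ l < N, ∀ k,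
        kappa (dataVec (x k) (d k (τ (l + 1)))) (G l (τ (l + 1))).1 ≠ 0) →
      ((∀ l < N,
          LieEKFStep drift
            (fun X => ∑ k, obs (dataVec (x k) (d k (τ (l + 1)))) X.1)
            (∑ k, y k (τ (l + 1))) S (Q (l + 1)) (τ l) (τ (l + 1))
            (Gpost l) (Ppost l) (G l) (P l) (Gpost (l + 1)) (Ppost (l + 1))) ↔
        (∀ l < N,
          AlgorithmStep drift adGVec phiVec (fun t => driftMatrix S (G l t)) S (Q (l + 1))
            (fun X => ∑ k, (y k (τ (l + 1)) - obs (dataVec (x k) (d k (τ (l + 1)))) X.1))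
            (obsMatrix (fun k => dataVec (x k) (d k (τ (l + 1)))) (G l (τ (l + 1))).1)
            (τ l) (τ (l + 1))
            (Gpost l) (Ppost l) (G l) (P l) (Gpost (l + 1)) (Ppost (l + 1))))) :=
  mainTheorem6_general n (fun k t => dataVec (x k) (d k t)) y S N τ Q
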